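/- For a real matrix $A\in\mathbb{R}^{p\times q}$ let $\|A\|_{\mathrm{tr}}=\sum_{i=1}^{\min(p,q)}\sigma_i(A)$ be its trace norm, where $\sigma_i(A)$ are the singular values of $A$. Let $X\in\mathbb{R}^{m\times n}$ have $\operatorname{rank}(X)=r$, let $d\ge r$ be an integer, and define the bi-trace and tri-trace quasi-norms of $X$ by $$\|X\|_{\text{Bi-tr}}=\min_{\substack{U\in\mathbb{R}^{m\times d},\,V\in\mathbb{R}^{n\times d}\\ X=UV^T}}\|U\|_{\mathrm{tr}}\|V\|_{\mathrm{tr}},\qquad \|X\|_{\text{Tri-tr}}=\min_{\substack{U\in\mathbb{R}^{m\times d},\,V\in\mathbb{R}^{d\times d},\,W\in\mathbb{R}^{n\times d}\\ X=UVW^T}}\|U\|_{\mathrm{tr}}\|V\|_{\mathrm{tr}}\|W\|_{\mathrm{tr}}.$$ Then both minima are attained, and $$\|X\|_{\mathrm{tr}}\le\|X\|_{\text{Bi-tr}}\le r\,\|X\|_{\mathrm{tr}},$$ $$\|X\|_{\mathrm{tr}}\le\|X\|_{\text{Bi-tr}}\le\|X\|_{\text{Tri-tr}}\le r^2\,\|X\|_{\mathrm{tr}}.$$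 -/

import Mathlib

/-- The `i`-th singular value (counted from `0`, in decreasing order, with multiplicity) of a real
`m × n` matrix, as a linear map `ℝⁿ → ℝᵐ` between Euclidean spaces. -/
noncomputable def matSingularValue {m n : ℕ} (X : Matrix (Fin m) (Fin n) ℝ) (i : ℕ) : ℝ :=
  (Matrix.toEuclideanLin X).singularValues i

/-- The trace norm `‖X‖_tr`: the sum of the `min (m, n)` singular values of `X`. -/
noncomputable def trNorm {m n : ℕ} (X : Matrix (Fin m) (Fin n) ℝ) : ℝ :=
  ∑ i ∈ Finset.range (min m n), matSingularValue X i

/-- The values `‖U‖_tr ‖V‖_tr` over all factorizations `X = U Vᵀ` of inner dimension `d`. -/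
def biTrValues {m n : ℕ} (d : ℕ) (X : Matrix (Fin m) (Fin n) ℝ) : Set ℝ :=
  {c | ∃ (U : Matrix (Fin m) (Fin d) ℝ) (V : Matrix (Fin n) (Fin d) ℝ),
    X = U * V.transpose ∧ c = trNorm U * trNorm V}

/-- The values `‖U‖_tr ‖V‖_tr ‖W‖_tr` over all factorizations `X = U V Wᵀ` of inner
dimension `d`. -/
def triTrValues {m n : ℕ} (d : ℕ) (X : Matrix (Fin m) (Fin n) ℝ) : Set ℝ :=
  {c | ∃ (U : Matrix (Fin m) (Fin d) ℝ) (V : Matrix (Fin d) (Fin d) ℝ)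
      (W : Matrix (Fin n) (Fin d) ℝ),
    X = U * V * W.transpose ∧ c = trNorm U * trNorm V * trNorm W}

/-- The bi-trace quasi-norm with inner dimension `d`. For `rank X ≤ d` the infimum is a minimum;
this is claimed in the theorem. -/
noncomputable def biTrNorm {m n : ℕ} (d : ℕ) (X : Matrix (Fin m) (Fin n) ℝ) : ℝ :=
  sInf (biTrValues d X)

/-- The tri-trace quasi-norm with inner dimension `d`. For `rank X ≤ d` the infimum is a minimum;
this is claimed in the theorem. -/
noncomputable def triTrNorm {m n : ℕ} (d : ℕ) (X : Matrix (Fin m) (Fin n) ℝ) : ℝ :=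
  sInf (triTrValues d X)


/-!
The trace norm of `T` is the least value of `∑ i, ‖x i‖ * ‖y i‖` over all ways to write `T` as a sum
of rank-one maps `x i ⊗ (y i)*`. The singular value decomposition attains this value, and pairing
`T` with its own singular vectors shows by Cauchy–Schwarz and Bessel that no decomposition does
better. Hence the trace norm is a norm, invariant under adjoints and submultiplicative, which gives
all the lower bounds.

For the upper bounds, split each singular value `σ i` as `√(σ i) * √(σ i)`, give one root to each
factor, and let the factors meet along an orthonormal family of `r` vectors in the middle space.
Both factors then have trace norm at most `∑ i, √(σ i)`, whose square is at most `r * ‖T‖` by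
Cauchy–Schwarz. A third factor is the projection onto the span of that family, which has trace norm
at most `r`.

Moving the norms of all factors but the last into the last one changes neither the composition nor
the product of norms and puts the other factors into unit balls, so both minima are attained by
compactness.
-/

open Module InnerProductSpace

section RankOneSum

variable {𝕜 E F G ι κ : Type*} [RCLike 𝕜] [Fintype ι] [Fintype κ]
  [NormedAddCommGroup E] [InnerProductSpace 𝕜 E]
  [NormedAddCommGroup F] [InnerProductSpace 𝕜 F]
  [NormedAddCommGroup G] [InnerProductSpace 𝕜 G]

variable (𝕜) in
/-- The operator `∑ i, x i ⊗ (y i)*`, the coordinate-free form of the matrix product of the columns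
`x i` with the conjugate-transposed columns `y i`. The vectors are not normalized: they carry the
weights of the sum. -/
noncomputable def rankOneSum (x : ι → F) (y : ι → E) : E →ₗ[𝕜] F :=
  ∑ i, (rankOne 𝕜 (x i) (y i)).toLinearMap

@[simp]
theorem rankOneSum_apply (x : ι → F) (y : ι → E) (z : E) :
    rankOneSum 𝕜 x y z = ∑ i, ⟪y i, z⟫_𝕜 • x i := by
  simp [rankOneSum]

theorem rankOneSum_smul_left (a : 𝕜) (x : ι → F) (y : ι → E) :
    rankOneSum 𝕜 (a • x) y = a • rankOneSum 𝕜 x y := by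
  ext z
  simp [Finset.smul_sum, smul_comm a]

theorem rankOneSum_sumElim (x : ι → F) (y : ι → E) (x' : κ → F) (y' : κ → E) :
    rankOneSum 𝕜 (Sum.elim x x') (Sum.elim y y') = rankOneSum 𝕜 x y + rankOneSum 𝕜 x' y' := by
  ext z
  simp

theorem comp_rankOneSum (A : F →ₗ[𝕜] G) (x : ι → F) (y : ι → E) :
    A ∘ₗ rankOneSum 𝕜 x y = rankOneSum 𝕜 (A ∘ x) y := by
  ext z
  simp

theorem rankOneSum_comp_rankOneSum {w : ι → F} (hw : Orthonormal 𝕜 w) (x : ι → G) (y : ι → E) :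
    rankOneSum 𝕜 x w ∘ₗ rankOneSum 𝕜 w y = rankOneSum 𝕜 x y := by
  classical
  have hwx : rankOneSum 𝕜 x w ∘ w = x := by
    ext j
    simp [orthonormal_iff_ite.1 hw]
  rw [comp_rankOneSum, hwx]

theorem adjoint_rankOneSum [FiniteDimensional 𝕜 E] [FiniteDimensional 𝕜 F] (x : ι → F)
    (y : ι → E) : (rankOneSum 𝕜 x y).adjoint = rankOneSum 𝕜 y x := by
  refine ((LinearMap.eq_adjoint_iff _ _).2 fun a b => ?_).symm
  simp [sum_inner, inner_sum, inner_smul_left, inner_smul_right, mul_comm]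

theorem sum_norm_inner_mul_norm_inner_le {u : κ → F} {v : κ → E} (hu : Orthonormal 𝕜 u)
    (hv : Orthonormal 𝕜 v) (x : F) (y : E) :
    ∑ j, ‖⟪u j, x⟫_𝕜‖ * ‖⟪v j, y⟫_𝕜‖ ≤ ‖x‖ * ‖y‖ := by
  refine (Real.sum_mul_le_sqrt_mul_sqrt _ _ _).trans ?_
  gcongr
  · exact Real.sqrt_le_left (norm_nonneg x) |>.2 (hu.sum_inner_products_le x)
  · exact Real.sqrt_le_left (norm_nonneg y) |>.2 (hv.sum_inner_products_le y)

theorem norm_sum_inner_rankOneSum_le {u : κ → F} {v : κ → E} (hu : Orthonormal 𝕜 u)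
    (hv : Orthonormal 𝕜 v) (x : ι → F) (y : ι → E) :
    ‖∑ j, ⟪u j, rankOneSum 𝕜 x y (v j)⟫_𝕜‖ ≤ ∑ i, ‖x i‖ * ‖y i‖ := by
  calc ‖∑ j, ⟪u j, rankOneSum 𝕜 x y (v j)⟫_𝕜‖
      = ‖∑ i, ∑ j, ⟪u j, x i⟫_𝕜 * ⟪y i, v j⟫_𝕜‖ := by
        rw [Finset.sum_comm]
        simp only [rankOneSum_apply, inner_sum, inner_smul_right, mul_comm]
    _ ≤ ∑ i, ∑ j, ‖⟪u j, x i⟫_𝕜‖ * ‖⟪v j, y i⟫_𝕜‖ := by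
        refine norm_sum_le_of_le _ fun i _ => norm_sum_le_of_le _ fun j _ => ?_
        rw [norm_mul, norm_inner_symm (y i)]
    _ ≤ ∑ i, ‖x i‖ * ‖y i‖ :=
        Finset.sum_le_sum fun i _ => sum_norm_inner_mul_norm_inner_le hu hv (x i) (y i)

end RankOneSum

section TraceNorm

variable {𝕜 E F G ι : Type*} [RCLike 𝕜] [Fintype ι]
  [NormedAddCommGroup E] [InnerProductSpace 𝕜 E] [FiniteDimensional 𝕜 E]
  [NormedAddCommGroup F] [InnerProductSpace 𝕜 F] [FiniteDimensional 𝕜 F]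
  [NormedAddCommGroup G] [InnerProductSpace 𝕜 G] [FiniteDimensional 𝕜 G]

theorem exists_orthonormalBasis_inner_apply_apply (T : E →ₗ[𝕜] F) :
    ∃ e : OrthonormalBasis (Fin (finrank 𝕜 E)) 𝕜 E, ∀ i j,
      ⟪T (e i), T (e j)⟫_𝕜 = (T.singularValues j : 𝕜) ^ 2 * ⟪e i, e j⟫_𝕜 := by
  refine ⟨T.isSymmetric_adjoint_comp_self.eigenvectorBasis rfl, fun i j => ?_⟩
  rw [← LinearMap.adjoint_inner_right, ← LinearMap.comp_apply,
    T.isSymmetric_adjoint_comp_self.apply_eigenvectorBasis rfl j, inner_smul_right,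
    ← T.sq_singularValues_fin rfl, RCLike.ofReal_pow]

theorem exists_singularValueDecomposition (T : E →ₗ[𝕜] F) :
    ∃ (u : Fin (finrank 𝕜 T.range) → F) (v : Fin (finrank 𝕜 T.range) → E),
      Orthonormal 𝕜 u ∧ Orthonormal 𝕜 v ∧
        T = rankOneSum 𝕜 (fun i : Fin _ => (T.singularValues i : 𝕜) • u i) v := by
  obtain ⟨e, he⟩ := exists_orthonormalBasis_inner_apply_apply T
  have hrank : finrank 𝕜 T.range ≤ finrank 𝕜 E := T.finrank_range_le
  let v := e ∘ Fin.castLE hrank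
  have hv : Orthonormal 𝕜 v := e.orthonormal.comp _ (Fin.castLE_injective hrank)
  have hσ (i : Fin (finrank 𝕜 T.range)) : (T.singularValues i : 𝕜) ≠ 0 := by
    exact_mod_cast (T.singularValues_pos_iff_lt_finrank_range.2 i.2).ne'
  refine ⟨fun i => (T.singularValues i : 𝕜)⁻¹ • T (v i), v, ?_, hv, ?_⟩
  · rw [orthonormal_iff_ite] at hv ⊢
    intro i j
    have hij : ⟪T (v i), T (v j)⟫_𝕜 = (T.singularValues j : 𝕜) ^ 2 * ⟪v i, v j⟫_𝕜 :=
      he _ _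
    rw [inner_smul_left, inner_smul_right, hij, hv]
    split_ifs with h
    · subst h
      simpa [field] using hσ i
    · simp
  · have hker (j) (hj : j ∉ Set.range (Fin.castLE hrank)) : T (e j) = 0 := by
      have hj' : finrank 𝕜 T.range ≤ j := by
        by_contra! h
        exact hj ⟨⟨j, h⟩, rfl⟩
      rw [← inner_self_eq_zero (𝕜 := 𝕜), he,
        T.singularValues_eq_zero_iff_le_finrank_range.2 hj']
      simp
    ext z
    conv_lhs => rw [← e.sum_repr' z, map_sum]
    simp only [rankOneSum_apply, smul_inv_smul₀ (hσ _), map_smul]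
    exact (Fintype.sum_of_injective _ (Fin.castLE_injective hrank) _ _
      (fun j hj => by rw [hker j hj, smul_zero]) fun _ => rfl).symm

/-- The trace (nuclear, Schatten-1) norm of a linear map between finite-dimensional inner product
spaces. The singular values form a finitely supported sequence, which is summed over its support. -/
noncomputable def traceNorm (T : E →ₗ[𝕜] F) : ℝ :=
  T.singularValues.sum fun _ σ => σ

theorem traceNorm_eq_sum_fin (T : E →ₗ[𝕜] F) :
    traceNorm T = ∑ i : Fin (finrank 𝕜 T.range), T.singularValues i := by
  rw [traceNorm, Finsupp.sum, T.support_singularValues, Finset.sum_range]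

theorem traceNorm_nonneg (T : E →ₗ[𝕜] F) : 0 ≤ traceNorm T :=
  Finset.sum_nonneg fun i _ => T.singularValues_nonneg i

theorem traceNorm_zero : traceNorm (0 : E →ₗ[𝕜] F) = 0 := by
  simp [traceNorm]

theorem traceNorm_rankOneSum_le (x : ι → F) (y : ι → E) :
    traceNorm (rankOneSum 𝕜 x y) ≤ ∑ i, ‖x i‖ * ‖y i‖ := by
  set T := rankOneSum 𝕜 x y
  obtain ⟨u, v, hu, hv, hsvd⟩ := exists_singularValueDecomposition T
  have hTv (j) : T (v j) = (T.singularValues j : 𝕜) • u j := by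
    simpa [orthonormal_iff_ite.1 hv] using LinearMap.congr_fun hsvd (v j)
  have hdual : (traceNorm T : 𝕜) = ∑ j, ⟪u j, T (v j)⟫_𝕜 := by
    simp [traceNorm_eq_sum_fin, hTv, inner_smul_right, inner_self_eq_norm_sq_to_K, hu.1]
  calc traceNorm T = ‖(traceNorm T : 𝕜)‖ := by simp [abs_of_nonneg (traceNorm_nonneg T)]
    _ = ‖∑ j, ⟪u j, T (v j)⟫_𝕜‖ := by rw [hdual]
    _ ≤ ∑ i, ‖x i‖ * ‖y i‖ := norm_sum_inner_rankOneSum_le hu hv x y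

theorem exists_eq_rankOneSum_norm_eq_sqrt (T : E →ₗ[𝕜] F) :
    ∃ (x : Fin (finrank 𝕜 T.range) → F) (y : Fin (finrank 𝕜 T.range) → E),
      T = rankOneSum 𝕜 x y ∧
        ∀ i, ‖x i‖ = √(T.singularValues i) ∧ ‖y i‖ = √(T.singularValues i) := by
  obtain ⟨u, v, hu, hv, hsvd⟩ := exists_singularValueDecomposition T
  refine ⟨fun i => (√(T.singularValues i) : 𝕜) • u i, fun i => (√(T.singularValues i) : 𝕜) • v i,
    ?_, fun i => by simp [norm_smul, hu.1, hv.1, abs_of_nonneg]⟩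
  conv_lhs => rw [hsvd]
  ext z
  have hsqrt (i : ℕ) : (√(T.singularValues i) : 𝕜) * √(T.singularValues i) = T.singularValues i :=
    mod_cast Real.mul_self_sqrt (T.singularValues_nonneg i)
  simp only [rankOneSum_apply, inner_smul_left, RCLike.conj_ofReal, smul_smul]
  refine Finset.sum_congr rfl fun i _ => ?_
  rw [mul_right_comm, hsqrt, mul_comm]

theorem exists_eq_rankOneSum_traceNorm_eq (T : E →ₗ[𝕜] F) :
    ∃ (x : Fin (finrank 𝕜 T.range) → F) (y : Fin (finrank 𝕜 T.range) → E),
      T = rankOneSum 𝕜 x y ∧ traceNorm T = ∑ i, ‖x i‖ * ‖y i‖ := by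
  obtain ⟨x, y, hT, hxy⟩ := exists_eq_rankOneSum_norm_eq_sqrt T
  refine ⟨x, y, hT, ?_⟩
  simp only [traceNorm_eq_sum_fin, hxy, Real.mul_self_sqrt (T.singularValues_nonneg _)]

theorem traceNorm_add_le (S T : E →ₗ[𝕜] F) : traceNorm (S + T) ≤ traceNorm S + traceNorm T := by
  obtain ⟨x, y, hS, hS'⟩ := exists_eq_rankOneSum_traceNorm_eq S
  obtain ⟨x', y', hT, hT'⟩ := exists_eq_rankOneSum_traceNorm_eq T
  calc traceNorm (S + T) = traceNorm (rankOneSum 𝕜 (Sum.elim x x') (Sum.elim y y')) := by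
        rw [rankOneSum_sumElim, ← hS, ← hT]
    _ ≤ traceNorm S + traceNorm T := by
        simpa [hS', hT'] using traceNorm_rankOneSum_le (𝕜 := 𝕜) (Sum.elim x x') (Sum.elim y y')

theorem traceNorm_smul_le (a : 𝕜) (T : E →ₗ[𝕜] F) : traceNorm (a • T) ≤ ‖a‖ * traceNorm T := by
  obtain ⟨x, y, hT, hT'⟩ := exists_eq_rankOneSum_traceNorm_eq T
  calc traceNorm (a • T) = traceNorm (rankOneSum 𝕜 (a • x) y) := by
        rw [rankOneSum_smul_left, ← hT]
    _ ≤ ‖a‖ * traceNorm T := by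
        simpa [hT', norm_smul, mul_assoc, Finset.mul_sum]
          using traceNorm_rankOneSum_le (𝕜 := 𝕜) (a • x) y

theorem norm_apply_le_traceNorm_mul (T : E →ₗ[𝕜] F) (z : E) : ‖T z‖ ≤ traceNorm T * ‖z‖ := by
  obtain ⟨x, y, hT, hT'⟩ := exists_eq_rankOneSum_traceNorm_eq T
  calc ‖T z‖ = ‖∑ i, ⟪y i, z⟫_𝕜 • x i‖ := by rw [← rankOneSum_apply, ← hT]
    _ ≤ ∑ i, ‖x i‖ * ‖y i‖ * ‖z‖ := by
        refine norm_sum_le_of_le _ fun i _ => ?_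
        rw [norm_smul, mul_comm, mul_assoc]
        gcongr
        exact norm_inner_le_norm _ _
    _ = traceNorm T * ‖z‖ := by rw [hT', Finset.sum_mul]

theorem traceNorm_comp_le (A : F →ₗ[𝕜] G) (B : E →ₗ[𝕜] F) :
    traceNorm (A ∘ₗ B) ≤ traceNorm A * traceNorm B := by
  obtain ⟨x, y, hB, hB'⟩ := exists_eq_rankOneSum_traceNorm_eq B
  calc traceNorm (A ∘ₗ B) = traceNorm (rankOneSum 𝕜 (A ∘ x) y) := by
        rw [← comp_rankOneSum, ← hB]
    _ ≤ ∑ i, ‖A (x i)‖ * ‖y i‖ := traceNorm_rankOneSum_le _ _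
    _ ≤ ∑ i, traceNorm A * ‖x i‖ * ‖y i‖ := by
        gcongr
        exact norm_apply_le_traceNorm_mul A _
    _ = traceNorm A * traceNorm B := by simp only [hB', Finset.mul_sum, mul_assoc]

theorem traceNorm_adjoint_le (T : E →ₗ[𝕜] F) : traceNorm T.adjoint ≤ traceNorm T := by
  obtain ⟨x, y, hT, hT'⟩ := exists_eq_rankOneSum_traceNorm_eq T
  calc traceNorm T.adjoint = traceNorm (rankOneSum 𝕜 y x) := by rw [← adjoint_rankOneSum, ← hT]
    _ ≤ traceNorm T := by simpa [hT', mul_comm] using traceNorm_rankOneSum_le (𝕜 := 𝕜) y x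

theorem traceNorm_adjoint (T : E →ₗ[𝕜] F) : traceNorm T.adjoint = traceNorm T :=
  (traceNorm_adjoint_le T).antisymm (by simpa using traceNorm_adjoint_le T.adjoint)

end TraceNorm

section TraceNormedSpace

variable {𝕜 E F G : Type*} [RCLike 𝕜]
  [NormedAddCommGroup E] [InnerProductSpace 𝕜 E] [FiniteDimensional 𝕜 E]
  [NormedAddCommGroup F] [InnerProductSpace 𝕜 F] [FiniteDimensional 𝕜 F]
  [NormedAddCommGroup G] [InnerProductSpace 𝕜 G] [FiniteDimensional 𝕜 G]

variable (𝕜 E F) in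
/-- The trace norm as a seminorm, through which it becomes the norm of `E →ₗ[𝕜] F`. -/
noncomputable def traceSeminorm : Seminorm 𝕜 (E →ₗ[𝕜] F) :=
  Seminorm.ofSMulLE traceNorm traceNorm_zero traceNorm_add_le traceNorm_smul_le

/-- The norm on `E →ₗ[𝕜] F` given by the trace norm. It is only a local instance, since linear maps
carry several natural norms. -/
noncomputable abbrev traceNormInst : Norm (E →ₗ[𝕜] F) := ⟨traceNorm⟩

attribute [local instance] traceNormInst

theorem traceNorm_normedSpaceCore : NormedSpace.Core 𝕜 (E →ₗ[𝕜] F) where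
  norm_nonneg := traceNorm_nonneg
  norm_smul := map_smul_eq_mul (traceSeminorm 𝕜 E F)
  norm_triangle := traceNorm_add_le
  norm_eq_zero_iff T := by
    refine ⟨fun (hT : traceNorm T = 0) => ?_, fun hT => hT ▸ traceNorm_zero⟩
    ext z
    simpa [hT] using norm_apply_le_traceNorm_mul T z

/-- The trace norm as the norm of `E →ₗ[𝕜] F`, again only a local instance. -/
noncomputable abbrev traceNormedAddCommGroup : NormedAddCommGroup (E →ₗ[𝕜] F) :=
  .ofCore traceNorm_normedSpaceCore

attribute [local instance] traceNormedAddCommGroup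

/-- The scalar action that goes with `traceNormedAddCommGroup`. -/
noncomputable abbrev traceNormedSpace : NormedSpace 𝕜 (E →ₗ[𝕜] F) :=
  .ofCore traceNorm_normedSpaceCore

attribute [local instance] traceNormedSpace

theorem continuous_comp_traceNorm :
    Continuous fun p : (F →ₗ[𝕜] G) × (E →ₗ[𝕜] F) => p.1 ∘ₗ p.2 :=
  IsBoundedBilinearMap.continuous (𝕜 := 𝕜)
    { add_left := fun A A' B => LinearMap.add_comp B A' A
      smul_left := fun a A B => LinearMap.smul_comp a A B
      add_right := fun A B B' => LinearMap.comp_add B B' A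
      smul_right := fun a A B => LinearMap.comp_smul A a B
      bound := ⟨1, one_pos, fun A B => (traceNorm_comp_le A B).trans_eq (by rw [one_mul]; rfl)⟩ }

end TraceNormedSpace

section Minimizers

theorem exists_isLeast_image_mul_norm_fiber {𝕜 P Q H : Type*} [RCLike 𝕜] [TopologicalSpace P]
    [NormedAddCommGroup Q] [NormedSpace 𝕜 Q] [ProperSpace Q] [TopologicalSpace H] [T1Space H]
    {f : P × Q → H} (hf : Continuous f) {N : P → ℝ} (hN : ∀ p, 0 ≤ N p)
    {K : Set P} (hK : IsCompact K) (hNK : ∀ p ∈ K, N p ≤ 1)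
    (hnormalize : ∀ p q, ∃ p' ∈ K, f (p', (N p : 𝕜) • q) = f (p, q))
    {z : H} (hz : (f ⁻¹' {z}).Nonempty) :
    ∃ c, IsLeast ((fun x => N x.1 * ‖x.2‖) '' (f ⁻¹' {z})) c := by
  have hfiber : ∀ p q, f (p, q) = z → ∃ p' ∈ K, ∃ q', f (p', q') = z ∧ ‖q'‖ = N p * ‖q‖ := by
    intro p q hpq
    obtain ⟨p', hp', hf'⟩ := hnormalize p q
    exact ⟨p', hp', _, hf'.trans hpq, by simp [norm_smul, abs_of_nonneg (hN p)]⟩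
  obtain ⟨⟨p₁, q₁⟩, h₁⟩ := hz
  obtain ⟨p₀, hp₀, q₀, h₀, -⟩ := hfiber p₁ q₁ h₁
  have hcompact : IsCompact (f ⁻¹' {z} ∩ K ×ˢ Metric.closedBall 0 ‖q₀‖) :=
    (hK.prod (isCompact_closedBall 0 ‖q₀‖)).inter_left (isClosed_singleton.preimage hf)
  obtain ⟨⟨p, q⟩, ⟨hpq, hp, hq⟩, hmin⟩ := hcompact.exists_isMinOn
    ⟨(p₀, q₀), h₀, hp₀, by simp⟩ (f := fun x => ‖x.2‖) (by fun_prop)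
  have hle : ∀ p' ∈ K, ∀ q', f (p', q') = z → ‖q‖ ≤ ‖q'‖ := by
    intro p' hp' q' hf'
    obtain hq' | hq' := le_total ‖q'‖ ‖q₀‖
    · exact hmin (a := (p', q')) ⟨hf', hp', by simpa using hq'⟩
    · exact (mem_closedBall_zero_iff.1 hq).trans hq'
  refine ⟨N p * ‖q‖, ⟨(p, q), hpq, rfl⟩, ?_⟩
  rintro _ ⟨⟨p', q'⟩, hf', rfl⟩
  obtain ⟨p'', hp'', q'', hf'', hq''⟩ := hfiber p' q' hf'
  calc N p * ‖q‖ ≤ ‖q‖ := mul_le_of_le_one_left (norm_nonneg q) (hNK p hp)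
    _ ≤ ‖q''‖ := hle p'' hp'' q'' hf''
    _ = N p' * ‖q'‖ := hq''

theorem norm_inv_norm_smul_le_one (𝕜 : Type*) {P : Type*} [RCLike 𝕜] [NormedAddCommGroup P]
    [NormedSpace 𝕜 P] (p : P) : ‖(‖p‖⁻¹ : 𝕜) • p‖ ≤ 1 := by
  simpa [norm_smul] using inv_mul_le_one

theorem norm_smul_inv_norm_smul (𝕜 : Type*) {P : Type*} [RCLike 𝕜] [NormedAddCommGroup P]
    [NormedSpace 𝕜 P] (p : P) : (‖p‖ : 𝕜) • (‖p‖⁻¹ : 𝕜) • p = p := by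
  obtain rfl | hp := eq_or_ne p 0
  · simp
  · exact smul_inv_smul₀ (by simpa using hp) p

end Minimizers

section Factorizations

variable {𝕜 E F : Type*} [RCLike 𝕜]
  [NormedAddCommGroup E] [InnerProductSpace 𝕜 E] [FiniteDimensional 𝕜 E]
  [NormedAddCommGroup F] [InnerProductSpace 𝕜 F] [FiniteDimensional 𝕜 F]
  (D : Type*) [NormedAddCommGroup D] [InnerProductSpace 𝕜 D] [FiniteDimensional 𝕜 D]

/-- The products of trace norms over all factorizations of `T` through the space `D`. -/
def biTraceValues (T : E →ₗ[𝕜] F) : Set ℝ :=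
  {c | ∃ (U : D →ₗ[𝕜] F) (V : E →ₗ[𝕜] D), T = U ∘ₗ V ∧ c = traceNorm U * traceNorm V}

/-- The products of trace norms over all factorizations of `T` through an endomorphism of `D`. -/
def triTraceValues (T : E →ₗ[𝕜] F) : Set ℝ :=
  {c | ∃ (U : D →ₗ[𝕜] F) (V : D →ₗ[𝕜] D) (W : E →ₗ[𝕜] D),
    T = U ∘ₗ V ∘ₗ W ∧ c = traceNorm U * traceNorm V * traceNorm W}

/-- The bi-trace quasi-norm of a linear map, with factorizations through `D`. -/
noncomputable def biTraceNorm (T : E →ₗ[𝕜] F) : ℝ := sInf (biTraceValues D T)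

/-- The tri-trace quasi-norm of a linear map, with factorizations through `D`. -/
noncomputable def triTraceNorm (T : E →ₗ[𝕜] F) : ℝ := sInf (triTraceValues D T)

variable {D} {T : E →ₗ[𝕜] F}

attribute [local instance] traceNormedAddCommGroup traceNormedSpace

theorem isLeast_biTraceNorm (hT : (biTraceValues D T).Nonempty) :
    IsLeast (biTraceValues D T) (biTraceNorm D T) := by
  have : ProperSpace (D →ₗ[𝕜] F) := FiniteDimensional.proper 𝕜 _
  have : ProperSpace (E →ₗ[𝕜] D) := FiniteDimensional.proper 𝕜 _
  let comp : (D →ₗ[𝕜] F) × (E →ₗ[𝕜] D) → E →ₗ[𝕜] F := fun p => p.1 ∘ₗ p.2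
  have himage : biTraceValues D T = (fun p => ‖p.1‖ * ‖p.2‖) '' (comp ⁻¹' {T}) := by
    ext c
    constructor
    · rintro ⟨U, V, h, rfl⟩
      exact ⟨(U, V), h.symm, rfl⟩
    · rintro ⟨⟨U, V⟩, h, rfl⟩
      exact ⟨U, V, h.symm, rfl⟩
  have hnormalize (U : D →ₗ[𝕜] F) (V : E →ₗ[𝕜] D) :
      ∃ U' ∈ Metric.closedBall 0 1, comp (U', (‖U‖ : 𝕜) • V) = comp (U, V) := by
    refine ⟨(‖U‖⁻¹ : 𝕜) • U, by simpa using norm_inv_norm_smul_le_one 𝕜 U, ?_⟩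
    simp only [comp, LinearMap.comp_smul, ← LinearMap.smul_comp, norm_smul_inv_norm_smul]
  rw [himage] at hT
  obtain ⟨c, hc⟩ := exists_isLeast_image_mul_norm_fiber continuous_comp_traceNorm norm_nonneg
    (isCompact_closedBall 0 1) (fun U hU => by simpa using hU) hnormalize hT.of_image
  rw [← himage] at hc
  rwa [biTraceNorm, hc.csInf_eq]

theorem isLeast_triTraceNorm (hT : (triTraceValues D T).Nonempty) :
    IsLeast (triTraceValues D T) (triTraceNorm D T) := by
  have : ProperSpace (D →ₗ[𝕜] F) := FiniteDimensional.proper 𝕜 _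
  have : ProperSpace (D →ₗ[𝕜] D) := FiniteDimensional.proper 𝕜 _
  have : ProperSpace (E →ₗ[𝕜] D) := FiniteDimensional.proper 𝕜 _
  let comp : ((D →ₗ[𝕜] F) × (D →ₗ[𝕜] D)) × (E →ₗ[𝕜] D) → E →ₗ[𝕜] F :=
    fun p => p.1.1 ∘ₗ p.1.2 ∘ₗ p.2
  have hcont : Continuous comp :=
    continuous_comp_traceNorm.comp (continuous_fst.fst.prodMk
      (continuous_comp_traceNorm.comp (continuous_fst.snd.prodMk continuous_snd)))
  have himage : triTraceValues D T =
      (fun p => ‖p.1.1‖ * ‖p.1.2‖ * ‖p.2‖) '' (comp ⁻¹' {T}) := by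
    ext c
    constructor
    · rintro ⟨U, V, W, h, rfl⟩
      exact ⟨((U, V), W), h.symm, rfl⟩
    · rintro ⟨⟨⟨U, V⟩, W⟩, h, rfl⟩
      exact ⟨U, V, W, h.symm, rfl⟩
  have hnormalize (p : (D →ₗ[𝕜] F) × (D →ₗ[𝕜] D)) (W : E →ₗ[𝕜] D) :
      ∃ p' ∈ Metric.closedBall 0 1 ×ˢ Metric.closedBall 0 1,
        comp (p', ((‖p.1‖ * ‖p.2‖ : ℝ) : 𝕜) • W) = comp (p, W) := by
    refine ⟨((‖p.1‖⁻¹ : 𝕜) • p.1, (‖p.2‖⁻¹ : 𝕜) • p.2), ⟨?_, ?_⟩, ?_⟩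
    · simpa using norm_inv_norm_smul_le_one 𝕜 p.1
    · simpa using norm_inv_norm_smul_le_one 𝕜 p.2
    · simp only [comp, RCLike.ofReal_mul, mul_smul]
      rw [LinearMap.comp_smul, LinearMap.comp_smul, ← LinearMap.smul_comp,
        norm_smul_inv_norm_smul, LinearMap.comp_smul, ← LinearMap.smul_comp,
        norm_smul_inv_norm_smul]
  rw [himage] at hT
  obtain ⟨c, hc⟩ := exists_isLeast_image_mul_norm_fiber hcont
    (fun p => mul_nonneg (norm_nonneg p.1) (norm_nonneg p.2))
    ((isCompact_closedBall 0 1).prod (isCompact_closedBall 0 1))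
    (fun p hp => mul_le_one₀ (by simpa using hp.1) (norm_nonneg _) (by simpa using hp.2))
    hnormalize hT.of_image
  rw [← himage] at hc
  rwa [triTraceNorm, hc.csInf_eq]

theorem traceNorm_le_of_mem_biTraceValues {c : ℝ} (hc : c ∈ biTraceValues D T) :
    traceNorm T ≤ c := by
  obtain ⟨U, V, rfl, rfl⟩ := hc
  exact traceNorm_comp_le U V

theorem exists_mem_biTraceValues_le_of_mem_triTraceValues {c : ℝ} (hc : c ∈ triTraceValues D T) :
    ∃ b ∈ biTraceValues D T, b ≤ c := by
  obtain ⟨U, V, W, rfl, rfl⟩ := hc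
  refine ⟨_, ⟨U ∘ₗ V, W, (LinearMap.comp_assoc _ _ _).symm, rfl⟩, ?_⟩
  exact mul_le_mul_of_nonneg_right (traceNorm_comp_le U V) (traceNorm_nonneg W)

theorem exists_orthonormal_fin {r : ℕ} (hr : r ≤ finrank 𝕜 E) :
    ∃ w : Fin r → E, Orthonormal 𝕜 w :=
  ⟨stdOrthonormalBasis 𝕜 E ∘ Fin.castLE hr,
    (stdOrthonormalBasis 𝕜 E).orthonormal.comp _ (Fin.castLE_injective hr)⟩

theorem sq_sum_sqrt_singularValues_le (T : E →ₗ[𝕜] F) :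
    (∑ i : Fin (finrank 𝕜 T.range), √(T.singularValues i)) ^ 2 ≤
      finrank 𝕜 T.range * traceNorm T := by
  simpa [traceNorm_eq_sum_fin, Real.sq_sqrt (T.singularValues_nonneg _)] using
    sq_sum_le_card_mul_sum_sq (s := Finset.univ)
      (f := fun i : Fin (finrank 𝕜 T.range) => √(T.singularValues i))

theorem exists_balanced_factorization (hD : finrank 𝕜 T.range ≤ finrank 𝕜 D) :
    ∃ (U : D →ₗ[𝕜] F) (P : D →ₗ[𝕜] D) (V : E →ₗ[𝕜] D), T = U ∘ₗ V ∧ P ∘ₗ V = V ∧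
      traceNorm U * traceNorm V ≤ finrank 𝕜 T.range * traceNorm T ∧
        traceNorm P ≤ finrank 𝕜 T.range := by
  obtain ⟨w, hw⟩ := exists_orthonormal_fin hD
  obtain ⟨x, y, hT, hxy⟩ := exists_eq_rankOneSum_norm_eq_sqrt T
  let s := ∑ i : Fin (finrank 𝕜 T.range), √(T.singularValues i)
  have hU : traceNorm (rankOneSum 𝕜 x w) ≤ s := by
    simpa [s, hw.1, hxy] using traceNorm_rankOneSum_le (𝕜 := 𝕜) x w
  have hV : traceNorm (rankOneSum 𝕜 w y) ≤ s := by
    simpa [s, hw.1, hxy] using traceNorm_rankOneSum_le (𝕜 := 𝕜) w y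
  refine ⟨rankOneSum 𝕜 x w, rankOneSum 𝕜 w w, rankOneSum 𝕜 w y, ?_, ?_, ?_, ?_⟩
  · rwa [rankOneSum_comp_rankOneSum hw]
  · rw [rankOneSum_comp_rankOneSum hw]
  · calc traceNorm (rankOneSum 𝕜 x w) * traceNorm (rankOneSum 𝕜 w y)
        ≤ s * s := mul_le_mul hU hV (traceNorm_nonneg _) ((traceNorm_nonneg _).trans hU)
      _ = s ^ 2 := (sq s).symm
      _ ≤ finrank 𝕜 T.range * traceNorm T := sq_sum_sqrt_singularValues_le T
  · simpa [hw.1] using traceNorm_rankOneSum_le (𝕜 := 𝕜) w w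

theorem exists_mem_biTraceValues_le (hD : finrank 𝕜 T.range ≤ finrank 𝕜 D) :
    ∃ c ∈ biTraceValues D T, c ≤ finrank 𝕜 T.range * traceNorm T := by
  obtain ⟨U, -, V, hT, -, hUV, -⟩ := exists_balanced_factorization hD
  exact ⟨_, ⟨U, V, hT, rfl⟩, hUV⟩

theorem exists_mem_triTraceValues_le (hD : finrank 𝕜 T.range ≤ finrank 𝕜 D) :
    ∃ c ∈ triTraceValues D T, c ≤ (finrank 𝕜 T.range : ℝ) ^ 2 * traceNorm T := by
  obtain ⟨U, P, V, hT, hPV, hUV, hP⟩ := exists_balanced_factorization hD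
  refine ⟨_, ⟨U, P, V, by rw [hPV, hT], rfl⟩, ?_⟩
  calc traceNorm U * traceNorm P * traceNorm V
      = traceNorm P * (traceNorm U * traceNorm V) := by ring
    _ ≤ finrank 𝕜 T.range * (finrank 𝕜 T.range * traceNorm T) :=
        mul_le_mul hP hUV (mul_nonneg (traceNorm_nonneg U) (traceNorm_nonneg V))
          (Nat.cast_nonneg _)
    _ = (finrank 𝕜 T.range : ℝ) ^ 2 * traceNorm T := by ring

end Factorizations

theorem mainTheorem9_general {𝕜 E F : Type*} [RCLike 𝕜]
    [NormedAddCommGroup E] [InnerProductSpace 𝕜 E] [FiniteDimensional 𝕜 E]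
    [NormedAddCommGroup F] [InnerProductSpace 𝕜 F] [FiniteDimensional 𝕜 F]
    (D : Type*) [NormedAddCommGroup D] [InnerProductSpace 𝕜 D] [FiniteDimensional 𝕜 D]
    (T : E →ₗ[𝕜] F) (hD : finrank 𝕜 T.range ≤ finrank 𝕜 D) :
    IsLeast (biTraceValues D T) (biTraceNorm D T) ∧
    IsLeast (triTraceValues D T) (triTraceNorm D T) ∧
    (traceNorm T ≤ biTraceNorm D T ∧ biTraceNorm D T ≤ finrank 𝕜 T.range * traceNorm T) ∧
    (traceNorm T ≤ biTraceNorm D T ∧ biTraceNorm D T ≤ triTraceNorm D T ∧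
      triTraceNorm D T ≤ (finrank 𝕜 T.range : ℝ) ^ 2 * traceNorm T) := by
  obtain ⟨b, hb, hb_le⟩ := exists_mem_biTraceValues_le hD
  obtain ⟨t, ht, ht_le⟩ := exists_mem_triTraceValues_le hD
  have hbi : IsLeast (biTraceValues D T) (biTraceNorm D T) := isLeast_biTraceNorm ⟨b, hb⟩
  have htri : IsLeast (triTraceValues D T) (triTraceNorm D T) := isLeast_triTraceNorm ⟨t, ht⟩
  have hlower : traceNorm T ≤ biTraceNorm D T := traceNorm_le_of_mem_biTraceValues hbi.1
  obtain ⟨b', hb', hb'_le⟩ := exists_mem_biTraceValues_le_of_mem_triTraceValues htri.1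
  exact ⟨hbi, htri, ⟨hlower, (hbi.2 hb).trans hb_le⟩, hlower, (hbi.2 hb').trans hb'_le,
    (htri.2 ht).trans ht_le⟩

section Matrix

theorem surjective_transpose {ι κ R : Type*} :
    Function.Surjective (Matrix.transpose : Matrix ι κ R → Matrix κ ι R) :=
  fun A => ⟨A.transpose, A.transpose_transpose⟩

variable {m n : ℕ} (d : ℕ) (X : Matrix (Fin m) (Fin n) ℝ)

theorem finrank_range_toEuclideanLin :
    finrank ℝ (LinearMap.range X.toEuclideanLin) = X.rank := by
  rw [Matrix.toEuclideanLin, Matrix.toLpLin_eq_toLin]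
  exact (X.rank_eq_finrank_range_toLin _ _).symm

theorem trNorm_eq_traceNorm : trNorm X = traceNorm X.toEuclideanLin := by
  refine (Finsupp.sum_of_support_subset _ ?_ (fun _ σ => σ) fun _ _ => rfl).symm
  rw [LinearMap.support_singularValues, finrank_range_toEuclideanLin, Finset.range_subset_range]
  exact le_min (by simpa using X.rank_le_card_height) (by simpa using X.rank_le_card_width)

theorem trNorm_transpose : trNorm X.transpose = trNorm X := by
  rw [trNorm_eq_traceNorm, trNorm_eq_traceNorm, ← Matrix.conjTranspose_eq_transpose_of_trivial,
    Matrix.toEuclideanLin_conjTranspose_eq_adjoint, traceNorm_adjoint]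

theorem biTrValues_eq_biTraceValues :
    biTrValues d X = biTraceValues (EuclideanSpace ℝ (Fin d)) X.toEuclideanLin := by
  ext c
  simp only [biTrValues, biTraceValues, Set.mem_ofPred_eq, Matrix.toEuclideanLin.surjective.exists,
    (surjective_transpose (ι := Fin n) (κ := Fin d)).exists, ← Matrix.toLpLin_mul_same,
    Matrix.toEuclideanLin.injective.eq_iff, ← trNorm_eq_traceNorm, trNorm_transpose]

theorem triTrValues_eq_triTraceValues :
    triTrValues d X = triTraceValues (EuclideanSpace ℝ (Fin d)) X.toEuclideanLin := by
  ext c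
  simp only [triTrValues, triTraceValues, Set.mem_ofPred_eq, Matrix.mul_assoc,
    Matrix.toEuclideanLin.surjective.exists,
    (surjective_transpose (ι := Fin n) (κ := Fin d)).exists, ← Matrix.toLpLin_mul_same,
    Matrix.toEuclideanLin.injective.eq_iff, ← trNorm_eq_traceNorm, trNorm_transpose]

theorem biTrNorm_eq_biTraceNorm :
    biTrNorm d X = biTraceNorm (EuclideanSpace ℝ (Fin d)) X.toEuclideanLin := by
  rw [biTrNorm, biTrValues_eq_biTraceValues, biTraceNorm]

theorem triTrNorm_eq_triTraceNorm :
    triTrNorm d X = triTraceNorm (EuclideanSpace ℝ (Fin d)) X.toEuclideanLin := by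
  rw [triTrNorm, triTrValues_eq_triTraceValues, triTraceNorm]

end Matrix

theorem mainTheorem9 (m n d r : ℕ) (X : Matrix (Fin m) (Fin n) ℝ) (hr : X.rank = r) (hd : r ≤ d) :
    IsLeast (biTrValues d X) (biTrNorm d X) ∧
    IsLeast (triTrValues d X) (triTrNorm d X) ∧
    (trNorm X ≤ biTrNorm d X ∧ biTrNorm d X ≤ r * trNorm X) ∧
    (trNorm X ≤ biTrNorm d X ∧ biTrNorm d X ≤ triTrNorm d X ∧
      triTrNorm d X ≤ (r : ℝ) ^ 2 * trNorm X) := by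
  rw [biTrValues_eq_biTraceValues, triTrValues_eq_triTraceValues, biTrNorm_eq_biTraceNorm,
    triTrNorm_eq_triTraceNorm, trNorm_eq_traceNorm, ← hr, ← finrank_range_toEuclideanLin]
  exact mainTheorem9_general _ _ (by simpa [finrank_range_toEuclideanLin, hr] using hd)
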